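/- Theorem (Metric Distortion). Let $(M,g_M)$ and $(N,g_N)$ be connected smooth Riemannian manifolds (without boundary) of the same dimension $n$, and let $F:M\to N$ be a diffeomorphism. Write $|v|_{g}=\sqrt{g(v,v)}$ for the length of a tangent vector $v$, let $F^*g_N(u,v)=g_N(dF\,u,dF\,v)$ be the pullback of $g_N$ under $F$, and let $$d_{g}(p,q)=\inf_{\pi}\int_0^1|\pi'(t)|_{g}\,dt$$ be the Riemannian distance, the infimum being over all smooth curves $\pi:[0,1]\to M$ (respectively $N$) with $\pi(0)=p$ and $\pi(1)=q$. Then the metric distortion range of $F$ equals the distance distortion range of $F$; that is, as closed subsets of $\mathbb{R}$, $$\overline{\left\{\frac{|v|_{F^*g_N}}{|v|_{g_M}} : p\in M,\ v\in T_pM,\ v\neq 0\right\}}=\overline{\left\{\frac{d_{g_N}(F(p),F(q))}{d_{g_M}(p,q)} : p,q\in M,\ p\neq q\right\}}.$$ -/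

import Mathlib

open Set Bundle
open scoped Manifold ContDiff

noncomputable section

namespace MetricDistortion

/-- The Riemannian distance between two points `p`, `q` of a Riemannian manifold: the infimum of
the lengths `∫₀¹ |γ'(t)| dt` over all smooth curves `γ : [0,1] → M` with `γ 0 = p`, `γ 1 = q`.
(The length is an integral with values in `[0, ∞]`, and on a connected manifold the infimum is
finite, so that taking the real value loses nothing.) -/
def riemDist {E : Type*} [NormedAddCommGroup E] [NormedSpace ℝ E]
    {H : Type*} [TopologicalSpace H] (I : ModelWithCorners ℝ E H)
    {M : Type*} [TopologicalSpace M] [ChartedSpace H M]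
    [RiemannianBundle (fun x : M ↦ TangentSpace I x)] (p q : M) : ℝ :=
  (⨅ (γ : ℝ → M) (_ : ContMDiffOn 𝓘(ℝ, ℝ) I ∞ γ (Icc 0 1)) (_ : γ 0 = p) (_ : γ 1 = q),
    Manifold.pathELength I γ 0 1).toReal

section

variable {E : Type*} [NormedAddCommGroup E] [NormedSpace ℝ E]
  {H : Type*} [TopologicalSpace H] (I : ModelWithCorners ℝ E H)
  {M : Type*} [TopologicalSpace M] [ChartedSpace H M]
  [RiemannianBundle (fun x : M ↦ TangentSpace I x)]
  {E' : Type*} [NormedAddCommGroup E'] [NormedSpace ℝ E']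
  {H' : Type*} [TopologicalSpace H'] (J : ModelWithCorners ℝ E' H')
  {N : Type*} [TopologicalSpace N] [ChartedSpace H' N]
  [RiemannianBundle (fun x : N ↦ TangentSpace J x)]

/-- The pullback under `F : M → N` of the Riemannian metric of `N`:
`(F^* g_N)(u, v) = g_N(dF u, dF v)` for tangent vectors `u`, `v` of `M` at `p`. -/
def pullbackInner (F : M → N) (p : M) (u v : TangentSpace I p) : ℝ :=
  inner ℝ (mfderiv I J F p u : TangentSpace J (F p)) (mfderiv I J F p v : TangentSpace J (F p))

/-- The metric distortion range of `F`: the closure of the set of all ratios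
`|v|_{F^* g_N} / |v|_{g_M}`, where `v` is a nonzero tangent vector of `M`. -/
def metricDistortionRange (F : M → N) : Set ℝ :=
  closure {r : ℝ | ∃ (p : M) (v : TangentSpace I p), v ≠ 0 ∧
    r = √(pullbackInner I J F p v v) / √(inner ℝ v v)}

/-- The distance distortion range of `F`: the closure of the set of all ratios
`d_N(F p, F q) / d_M(p, q)`, where `p`, `q` are distinct points of `M`. -/
def distanceDistortionRange (F : M → N) : Set ℝ :=
  closure {r : ℝ | ∃ p q : M, p ≠ q ∧ r = riemDist J (F p) (F q) / riemDist I p q}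

end

end MetricDistortion

end

/-! Both inclusions compare infinitesimal lengths with distances, in opposite directions. A length
ratio is a limit of distance ratios: if `c` is a curve with `c'(0) = v`, then `d(c 0, c t) / t`
tends to `|v|` as `t → 0+`, and likewise for `F ∘ c`, so the quotients tend to `|dF v| / |v|`. This
is `tendsto_riemDist_div`, which rests on the equivalence of the distance with the chart norm in
`riemDist_isEquivalent_norm_symmL`. Conversely, suppose a distance ratio `R` has a gap `ε` around it
free of length ratios. By connectedness all length ratios lie on one side of `R`
(`stretchExcess_nonpos_or_nonneg`). If they lie below, integrating along curves (`riemDist_map_le`)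
makes every distance ratio strictly less than `R`; if above, the same argument for `F.symm` makes it
strictly greater. Either way `R` is not attained. -/

namespace MetricDistortion

open Filter MeasureTheory Manifold
open scoped ENNReal NNReal Topology

/-! ### The distance defined by smooth curves -/

section SmoothEDist

variable {E : Type*} [NormedAddCommGroup E] [NormedSpace ℝ E]
  {H : Type*} [TopologicalSpace H] (I : ModelWithCorners ℝ E H)
  {M : Type*} [TopologicalSpace M] [ChartedSpace H M]
  [RiemannianBundle (fun x : M ↦ TangentSpace I x)]

/-- The extended Riemannian distance defined by smooth curves. -/
noncomputable def smoothEDist (p q : M) : ℝ≥0∞ :=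
  ⨅ (γ : ℝ → M) (_ : ContMDiffOn 𝓘(ℝ, ℝ) I ∞ γ (Icc 0 1)) (_ : γ 0 = p) (_ : γ 1 = q),
    pathELength I γ 0 1

lemma riemDist_eq_toReal_smoothEDist (p q : M) :
    riemDist I p q = (smoothEDist I p q).toReal := rfl

variable {I} {x y z : M} {r : ℝ≥0∞} {a b : ℝ}

lemma exists_lt_of_smoothEDist_lt (hr : smoothEDist I x y < r) :
    ∃ γ : ℝ → M, γ 0 = x ∧ γ 1 = y ∧ CMDiff[Icc 0 1] ∞ γ ∧ pathELength I γ 0 1 < r := by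
  simp only [smoothEDist, iInf_lt_iff, exists_prop] at hr
  obtain ⟨γ, hγ, h0, h1, hlt⟩ := hr
  exact ⟨γ, h0, h1, hγ, hlt⟩

lemma riemannianEDist_le_smoothEDist : riemannianEDist I x y ≤ smoothEDist I x y := by
  refine le_of_forall_gt fun r hr ↦ ?_
  obtain ⟨γ, h0, h1, hγ, hlt⟩ := exists_lt_of_smoothEDist_lt hr
  exact (riemannianEDist_le_pathELength (hγ.of_le (by simp)) h0 h1 zero_le_one).trans_lt hlt

lemma smoothEDist_le_pathELength {γ : ℝ → M} (hγ : CMDiff[Icc a b] ∞ γ)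
    (ha : γ a = x) (hb : γ b = y) (hab : a ≤ b) :
    smoothEDist I x y ≤ pathELength I γ a b := by
  let η : ℝ →ᴬ[ℝ] ℝ := ContinuousAffineMap.lineMap a b
  have hη : CMDiff[Icc 0 1] ∞ (γ ∘ η) := by
    apply hγ.comp
    · rw [contMDiffOn_iff_contDiffOn]
      exact η.contDiff.contDiffOn
    · rw [← image_subset_iff, ContinuousAffineMap.coe_lineMap_eq, ← segment_eq_image_lineMap]
      simp [hab]
  have h : smoothEDist I x y ≤ pathELength I (γ ∘ η) 0 1 := by
    refine iInf_le_of_le (γ ∘ η) (iInf_le_of_le hη (iInf_le_of_le ?_ (iInf_le_of_le ?_ le_rfl)))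
    · simp [η, ContinuousAffineMap.coe_lineMap_eq, ha]
    · simp [η, ContinuousAffineMap.coe_lineMap_eq, hb]
  refine h.trans_eq ?_
  rw [pathELength_comp_of_monotoneOn zero_le_one _ η.differentiableOn]
  · simp [η, ContinuousAffineMap.coe_lineMap_eq]
  · simpa [η, ContinuousAffineMap.coe_lineMap_eq] using hγ.mdifferentiableOn (by simp)
  · exact (AffineMap.lineMap_mono (k := ℝ) hab).monotoneOn _

/-- A monotone reparametrization by a smooth step leaves the length unchanged and makes the curve
stationary near both ends. Such curves are smooth on all of `ℝ` and can be glued smoothly, as the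
triangle inequality requires. -/
lemma exists_lt_locally_constant_of_smoothEDist_lt
    (hr : smoothEDist I x y < r) (hab : a < b) :
    ∃ γ : ℝ → M, γ a = x ∧ γ b = y ∧ CMDiff ∞ γ ∧
    pathELength I γ a b < r ∧ γ =ᶠ[𝓝 a] (fun _ ↦ x) ∧ γ =ᶠ[𝓝 b] (fun _ ↦ y) := by
  rcases exists_lt_of_smoothEDist_lt hr with ⟨γ, hγx, hγy, γ_smooth, hγ⟩
  rcases exists_between hab with ⟨a₁, h_left, h_rest⟩
  rcases exists_between h_rest with ⟨b₁, h_mid, h_right⟩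
  let η (t : ℝ) : ℝ := Real.smoothTransition ((b₁ - a₁)⁻¹ * (t - a₁))
  have A (t) (ht : t < a₁) : η t = 0 := by
    simp only [η, Real.smoothTransition.zero_iff_nonpos]
    apply mul_nonpos_of_nonneg_of_nonpos
    · simpa using h_mid.le
    · linarith
  have A' (t) (ht : t < a₁) : (γ ∘ η) t = x := by simp [A t ht, hγx]
  have B (t) (ht : b₁ < t) : η t = 1 := by
    simp only [η, Real.smoothTransition.eq_one_iff_one_le, inv_mul_eq_div]
    rw [one_le_div₀] <;> linarith
  have B' (t) (ht : b₁ < t) : (γ ∘ η) t = y := by simp [B t ht, hγy]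
  refine ⟨γ ∘ η, A' _ h_left, B' _ h_right, ?_, ?_, ?_, ?_⟩
  · rw [← contMDiffOn_univ]
    apply γ_smooth.comp
    · rw [contMDiffOn_univ, contMDiff_iff_contDiff]
      fun_prop
    · intro t ht
      exact ⟨Real.smoothTransition.nonneg _, Real.smoothTransition.le_one _⟩
  · convert! hγ using 1
    rw [← A a h_left, ← B b h_right]
    apply pathELength_comp_of_monotoneOn hab.le
    · apply Monotone.monotoneOn
      apply Real.smoothTransition.monotone.comp
      intro t u htu
      dsimp only
      gcongr
    · simp only [η]
      apply (ContDiff.contDiffOn _).differentiableOn one_ne_zero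
      fun_prop
    · rw [A a h_left, B b h_right]
      exact γ_smooth.mdifferentiableOn (by simp)
  · filter_upwards [Iio_mem_nhds h_left] with t ht using A' t ht
  · filter_upwards [Ioi_mem_nhds h_right] with t ht using B' t ht

lemma smoothEDist_comm : smoothEDist I x y = smoothEDist I y x := by
  suffices H : ∀ x y : M, smoothEDist I y x ≤ smoothEDist I x y from le_antisymm (H y x) (H x y)
  intro x y
  refine le_of_forall_gt fun r hr ↦ ?_
  rcases exists_lt_locally_constant_of_smoothEDist_lt hr zero_lt_one
    with ⟨γ, γ0, γ1, γ_smooth, hγ, -⟩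
  let η : ℝ → ℝ := fun t ↦ -t
  have h_smooth : CMDiff ∞ (γ ∘ η) := by
    apply γ_smooth.comp ?_
    simp only [contMDiff_iff_contDiff]
    fun_prop
  have : smoothEDist I y x ≤ pathELength I (γ ∘ η) (η 1) (η 0) := by
    apply smoothEDist_le_pathELength h_smooth.contMDiffOn <;> simp [η, γ0, γ1]
  rw [← pathELength_comp_of_antitoneOn zero_le_one] at this; rotate_left
  · exact monotone_id.neg.antitoneOn _
  · exact differentiableOn_neg _
  · exact h_smooth.contMDiffOn.mdifferentiableOn (by simp)
  apply this.trans_lt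
  convert! hγ
  ext t
  simp [η]

lemma smoothEDist_triangle : smoothEDist I x z ≤ smoothEDist I x y + smoothEDist I y z := by
  refine le_of_forall_gt fun r hr ↦ ?_
  rcases ENNReal.exists_add_lt_of_add_lt hr with ⟨u, hu, v, hv, huv⟩
  rcases exists_lt_locally_constant_of_smoothEDist_lt hu zero_lt_one with
    ⟨γ₁, hγ₁0, hγ₁1, hγ₁_smooth, hγ₁, -, hγ₁_const⟩
  rcases exists_lt_locally_constant_of_smoothEDist_lt hv one_lt_two with
    ⟨γ₂, hγ₂1, hγ₂2, hγ₂_smooth, hγ₂, hγ₂_const, -⟩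
  let γ := piecewise (Iic 1) γ₁ γ₂
  have : smoothEDist I x z ≤ pathELength I γ 0 2 := by
    apply smoothEDist_le_pathELength
    · apply ContMDiff.contMDiffOn
      exact ContMDiff.piecewise_Iic hγ₁_smooth hγ₂_smooth (hγ₁_const.trans hγ₂_const.symm)
    · simp [γ, hγ₁0]
    · simp [γ, hγ₂2]
    · exact zero_le_two
  apply this.trans_lt (lt_trans ?_ huv)
  rw [← pathELength_add zero_le_one one_le_two]
  gcongr
  · convert! hγ₁ using 1
    apply pathELength_congr
    intro t ht
    simp [γ, ht.2]
  · convert! hγ₂ using 1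
    apply pathELength_congr_Ioo
    intro t ht
    simp [γ, ht.1]

end SmoothEDist

/-! ### Maps with bounded differential -/

section Map

variable {E : Type*} [NormedAddCommGroup E] [NormedSpace ℝ E]
  {H : Type*} [TopologicalSpace H] {I : ModelWithCorners ℝ E H}
  {M : Type*} [TopologicalSpace M] [ChartedSpace H M]
  [RiemannianBundle (fun x : M ↦ TangentSpace I x)]
  {E' : Type*} [NormedAddCommGroup E'] [NormedSpace ℝ E']
  {H' : Type*} [TopologicalSpace H'] {J : ModelWithCorners ℝ E' H'}
  {N : Type*} [TopologicalSpace N] [ChartedSpace H' N]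
  [RiemannianBundle (fun x : N ↦ TangentSpace J x)]

/-- A smooth map whose differential expands lengths by a factor at most `C` expands the distances
by a factor at most `C`. -/
lemma smoothEDist_map_le {F : M → N} (hF : ContMDiff I J ∞ F) {C : ℝ≥0} (hC₀ : 0 < C)
    (hC : ∀ (p : M) (v : TangentSpace I p),
      ‖(mfderiv I J F p v : TangentSpace J (F p))‖ₑ ≤ C * ‖v‖ₑ) (p q : M) :
    smoothEDist J (F p) (F q) ≤ C * smoothEDist I p q := by
  rcases eq_or_ne (smoothEDist I p q) ∞ with h | h
  · simp [h, hC₀.ne']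
  have hC₁ : (C : ℝ≥0∞) ≠ 0 := by simpa using hC₀.ne'
  suffices H : smoothEDist J (F p) (F q) / C ≤ smoothEDist I p q by
    rwa [ENNReal.div_le_iff hC₁ ENNReal.coe_ne_top, mul_comm] at H
  refine le_of_forall_gt fun r hr ↦ ?_
  obtain ⟨γ, h0, h1, hγ, hlt⟩ := exists_lt_of_smoothEDist_lt hr
  refine lt_of_le_of_lt ?_ hlt
  rw [ENNReal.div_le_iff hC₁ ENNReal.coe_ne_top, mul_comm]
  refine (smoothEDist_le_pathELength (hF.comp_contMDiffOn hγ) (by simp [h0]) (by simp [h1])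
    zero_le_one).trans ?_
  rw [pathELength_eq_lintegral_mfderiv_Ioo, pathELength_eq_lintegral_mfderiv_Ioo,
    ← lintegral_const_mul' _ _ ENNReal.coe_ne_top]
  refine setLIntegral_mono' measurableSet_Ioo fun t ht ↦ ?_
  have hd : MDiffAt γ t :=
    (hγ.contMDiffAt (Icc_mem_nhds ht.1 ht.2)).mdifferentiableAt (by simp)
  rw [mfderiv_comp t (hF.mdifferentiableAt (by simp)) hd]
  exact hC _ _

end Map

lemma enorm_le_coe_mul_enorm_of_norm_le {V W : Type*} [SeminormedAddGroup V] [SeminormedAddGroup W]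
    {v : V} {w : W} {r : ℝ≥0} (h : ‖v‖ ≤ r * ‖w‖) : ‖v‖ₑ ≤ r * ‖w‖ₑ := by
  have h' : ‖v‖₊ ≤ r * ‖w‖₊ := h
  simpa [enorm] using ENNReal.coe_le_coe.2 h'

/-! ### Distance and chart norm near a point -/

section Local

variable {E : Type*} [NormedAddCommGroup E] [NormedSpace ℝ E]
  {H : Type*} [TopologicalSpace H] (I : ModelWithCorners ℝ E H)
  {M : Type*} [TopologicalSpace M] [ChartedSpace H M] [IsManifold I 1 M]
  [RiemannianBundle (fun x : M ↦ TangentSpace I x)]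

omit [RiemannianBundle (fun x : M ↦ TangentSpace I x)] in
lemma symmL_comp_continuousLinearMapAt_self (x : M) (v : TangentSpace I x) :
    (trivializationAt E (TangentSpace I) x).symmL ℝ x
      ((trivializationAt E (TangentSpace I) x).continuousLinearMapAt ℝ x v) = v :=
  (trivializationAt E (TangentSpace I) x).symmL_continuousLinearMapAt
    (FiberBundle.mem_baseSet_trivializationAt' x) v

omit [RiemannianBundle (fun x : M ↦ TangentSpace I x)] in
lemma continuousLinearMapAt_comp_symmL_self (x : M) (u : E) :
    (trivializationAt E (TangentSpace I) x).continuousLinearMapAt ℝ x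
      ((trivializationAt E (TangentSpace I) x).symmL ℝ x u) = u :=
  (trivializationAt E (TangentSpace I) x).continuousLinearMapAt_symmL
    (FiberBundle.mem_baseSet_trivializationAt' x) u

/-- A linear image of the chart at `x` which is `r`-Lipschitz infinitesimally on a set `U` is
controlled by the lengths of the curves staying inside `U`. -/
lemma enorm_map_extChartAt_sub_le_mul_pathELength {V : Type*} [NormedAddCommGroup V]
    [NormedSpace ℝ V] {x y : M} (L : E →L[ℝ] V) {U : Set M} {r : ℝ≥0}
    (hU : U ⊆ (chartAt H x).source)
    (hL : ∀ z ∈ U, ∀ w : TangentSpace I z,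
      ‖L (mfderiv I 𝓘(ℝ, E) (extChartAt I x) z w)‖ₑ ≤ r * ‖w‖ₑ)
    {γ : ℝ → M} (hγ : CMDiff[Icc 0 1] 1 γ) (h0 : γ 0 = x) (h1 : γ 1 = y)
    (hγU : ∀ t ∈ Icc (0 : ℝ) 1, γ t ∈ U) :
    ‖L (extChartAt I x y - extChartAt I x x)‖ₑ ≤ r * pathELength I γ 0 1 := by
  let γ' : ℝ → E := extChartAt I x ∘ γ
  have hγ' : ContDiffOn ℝ 1 γ' (Icc 0 1) := by
    rw [← contMDiffOn_iff_contDiffOn]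
    exact contMDiffOn_extChartAt.comp (I' := I) (t := (chartAt H x).source) hγ
      fun t ht ↦ hU (hγU t ht)
  have hLγ : ContDiffOn ℝ 1 (L ∘ γ') (Icc 0 1) := L.contDiff.comp_contDiffOn hγ'
  calc ‖L (extChartAt I x y - extChartAt I x x)‖ₑ
      = ‖(L ∘ γ') 1 - (L ∘ γ') 0‖ₑ := by simp [γ', h0, h1]
    _ ≤ ∫⁻ t in Icc 0 1, ‖derivWithin (L ∘ γ') (Icc 0 1) t‖ₑ :=
        enorm_sub_le_lintegral_derivWithin_Icc_of_contDiffOn_Icc hLγ zero_le_one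
    _ ≤ ∫⁻ t in Icc 0 1, r * ‖mfderiv[Icc 0 1] γ t 1‖ₑ := by
        refine setLIntegral_mono' measurableSet_Icc fun t ht ↦ ?_
        have hu := uniqueDiffOn_Icc (zero_lt_one' ℝ) t ht
        have h : mfderiv[Icc 0 1] γ' t =
            (mfderiv% (extChartAt I x) (γ t)) ∘L (mfderiv[Icc 0 1] γ t) := by
          apply mfderiv_comp_mfderivWithin
          · exact mdifferentiableAt_extChartAt (hU (hγU t ht))
          · exact hγ.mdifferentiableOn one_ne_zero _ ht
          · rwa [uniqueMDiffWithinAt_iff_uniqueDiffWithinAt]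
        have h' : derivWithin (L ∘ γ') (Icc 0 1) t =
            L (mfderiv I 𝓘(ℝ, E) (extChartAt I x) (γ t) (mfderiv[Icc 0 1] γ t 1)) := by
          have h'' := (hγ'.differentiableOn one_ne_zero t ht).hasDerivWithinAt
          rw [(L.hasFDerivAt.comp_hasDerivWithinAt t h'').derivWithin hu]
          congr 1
          rw [← fderivWithin_derivWithin, ← mfderivWithin_eq_fderivWithin]
          exact DFunLike.congr_fun h 1
        rw [h']
        exact hL _ (hγU t ht) _
    _ = r * pathELength I γ 0 1 := by
        rw [lintegral_const_mul' _ _ ENNReal.coe_ne_top,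
          pathELength_eq_lintegral_mfderivWithin_Icc]

variable [IsContinuousRiemannianBundle E (fun x : M ↦ TangentSpace I x)]

/-- Near `x` the trivialization moves vectors into the fibre at `x` with distortion below `r`, and a
short enough curve from `x` cannot leave that neighbourhood. The bound uses the infimum over `C^1`
curves, which is the smaller one, so the two distances never need to be shown equal. -/
lemma eventually_enorm_symmL_le_mul_riemannianEDist [RegularSpace M] (x : M)
    {r : ℝ≥0} (hr : 1 < r) :
    ∀ᶠ y in 𝓝 x, ‖(trivializationAt E (fun x : M ↦ TangentSpace I x) x).symmL ℝ x
      (extChartAt I x y - extChartAt I x x)‖ₑ ≤ r * riemannianEDist I x y := by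
  have hU := (eventually_norm_symmL_trivializationAt_self_comp_lt E
    (fun x : M ↦ TangentSpace I x) x (r := r) (mod_cast hr)).and (chart_source_mem_nhds H x)
  obtain ⟨c, c_pos, hc⟩ := setOfPred_riemannianEDist_lt_subset_nhds' I hU
  filter_upwards [eventually_riemannianEDist_lt I x c_pos] with y hy
  have hr₀ : (r : ℝ≥0∞) ≠ 0 := by simpa using (zero_lt_one.trans hr).ne'
  rw [mul_comm, ← ENNReal.div_le_iff hr₀ ENNReal.coe_ne_top]
  refine le_of_forall_gt fun ρ hρ ↦ ?_
  -- The minimum makes the curve both nearly optimal and short enough to stay in the neighbourhood.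
  obtain ⟨γ, h0, h1, hγ, hlt⟩ := exists_lt_of_riemannianEDist_lt (lt_min hρ hy)
  refine lt_of_le_of_lt ?_ (hlt.trans_le (min_le_left _ _))
  rw [ENNReal.div_le_iff hr₀ ENNReal.coe_ne_top, mul_comm]
  refine enorm_map_extChartAt_sub_le_mul_pathELength I
    ((trivializationAt E (fun x : M ↦ TangentSpace I x) x).symmL ℝ x) (U := {z | _ ∧ _})
    (fun z hz ↦ hz.2) (fun z hz w ↦ ?_) hγ h0 h1 (fun t ht ↦ hc ?_)
  · rw [← TangentBundle.continuousLinearMapAt_trivializationAt hz.2]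
    have h := ((trivializationAt E (fun x : M ↦ TangentSpace I x) x).symmL ℝ x ∘L
      (trivializationAt E (fun x : M ↦ TangentSpace I x) x).continuousLinearMapAt ℝ z)
        |>.le_of_opNorm_le
        hz.1.le w
    exact enorm_le_coe_mul_enorm_of_norm_le h
  · refine (riemannianEDist_le_pathELength (hγ.mono (Icc_subset_Icc_right ht.2)) h0 rfl
      ht.1).trans_lt ?_
    exact (pathELength_mono le_rfl ht.2).trans_lt (hlt.trans_le (min_le_right _ _))

/-- The straight segment in the chart is a smooth competitor whose velocity has constant
coordinates; its length in the fibre at each point is at most `r` times that in the fibre at `x`. -/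
lemma eventually_smoothEDist_le_mul_enorm_symmL [IsManifold I ∞ M] (x : M) {r : ℝ≥0} (hr : 1 < r) :
    ∀ᶠ y in 𝓝 x, smoothEDist I x y ≤
      r * ‖(trivializationAt E (fun x : M ↦ TangentSpace I x) x).symmL ℝ x
        (extChartAt I x y - extChartAt I x x)‖ₑ := by
  have hU := (eventually_norm_symmL_trivializationAt_comp_self_lt E
    (fun x : M ↦ TangentSpace I x) x (r := r) (mod_cast hr)).and (chart_source_mem_nhds H x)
  set U : Set M := {z | _ ∧ _}
  change U ∈ 𝓝 x at hU
  have hU' : (extChartAt I x).symm ⁻¹' U ∈ 𝓝 (extChartAt I x x) :=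
    extChartAt_preimage_mem_nhds hU
  obtain ⟨ρ, ρ_pos, hρ⟩ := Metric.mem_nhdsWithin_iff.1
    (inter_mem (extChartAt_target_mem_nhdsWithin x) (mem_nhdsWithin_of_mem_nhds hU'))
  have A : (extChartAt I x) ⁻¹' (Metric.ball (extChartAt I x x) ρ ∩ range I) ∈ 𝓝 x := by
    apply extChartAt_preimage_mem_nhds_of_mem_nhdsWithin (by simp)
    rw [inter_comm]
    exact inter_mem_nhdsWithin _ (Metric.ball_mem_nhds _ ρ_pos)
  filter_upwards [A, chart_source_mem_nhds H x] with y hy h'y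
  let η := ContinuousAffineMap.lineMap (R := ℝ) (extChartAt I x x) (extChartAt I x y)
  set γ := (extChartAt I x).symm ∘ η
  have hη : Icc 0 1 ⊆ ⇑η ⁻¹' ((extChartAt I x).target ∩ (extChartAt I x).symm ⁻¹' U) := by
    simp only [← image_subset_iff, ContinuousAffineMap.coe_lineMap_eq,
     ← segment_eq_image_lineMap, η]
    exact (((convex_ball _ _).inter I.convex_range).segment_subset (by simp [ρ_pos]) hy).trans hρ
  simp only [preimage_inter, subset_inter_iff] at hη
  have η_smooth : CMDiff[Icc 0 1] ∞ η := by
    apply ContMDiff.contMDiffOn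
    rw [contMDiff_iff_contDiff]
    exact ContinuousAffineMap.contDiff _
  have h : smoothEDist I x y ≤ pathELength I γ 0 1 := by
    apply smoothEDist_le_pathELength _ _ _ zero_le_one
    · exact (contMDiffOn_extChartAt_symm x).comp η_smooth hη.1
    · simp [γ, η, ContinuousAffineMap.coe_lineMap_eq]
    · simp [γ, η, ContinuousAffineMap.coe_lineMap_eq, h'y]
  refine h.trans ?_
  rw [pathELength_eq_lintegral_mfderivWithin_Icc]
  refine (setLIntegral_mono' (g := fun _ ↦ r *
    ‖(trivializationAt E (fun x : M ↦ TangentSpace I x) x).symmL ℝ x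
        (extChartAt I x y - extChartAt I x x)‖ₑ) measurableSet_Icc fun t ht ↦ ?_).trans (by simp)
  have h₁ : mfderiv[Icc 0 1] γ t =
      (mfderiv[range I] (extChartAt I x).symm (η t)) ∘L (mfderiv[Icc 0 1] η t) := by
    apply mfderivWithin_comp
    · exact mdifferentiableWithinAt_extChartAt_symm (hη.1 ht)
    · exact η_smooth.mdifferentiableOn (by simp) t ht
    · exact hη.1.trans (preimage_mono (extChartAt_target_subset_range x))
    · rw [uniqueMDiffWithinAt_iff_uniqueDiffWithinAt]
      exact uniqueDiffOn_Icc zero_lt_one t ht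
  have h₂ : mfderiv[Icc 0 1] η t 1 = extChartAt I x y - extChartAt I x x := by
    rw [mfderivWithin_eq_fderivWithin,
      fderivWithin_eq_fderiv (uniqueDiffOn_Icc zero_lt_one _ ht)
        (ContinuousAffineMap.differentiableAt _)]
    have h : HasDerivAt η (extChartAt I x y - extChartAt I x x) t :=
      AffineMap.hasDerivAt_lineMap
    rw [h.hasFDerivAt.fderiv]
    exact one_smul ℝ _
  have hz : γ t ∈ U := hη.2 ht
  have h₃ : mfderiv[Icc 0 1] γ t 1 =
      (trivializationAt E (fun x : M ↦ TangentSpace I x) x).symmL ℝ (γ t)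
        (extChartAt I x y - extChartAt I x x) := by
    rw [TangentBundle.symmL_trivializationAt hz.2, ← h₂]
    have : extChartAt I x (γ t) = η t := (extChartAt I x).right_inv (hη.1 ht)
    rw [this]
    exact DFunLike.congr_fun h₁ 1
  rw [h₃]
  have h₄ := ((trivializationAt E (fun x : M ↦ TangentSpace I x) x).symmL ℝ (γ t) ∘L
      (trivializationAt E (fun x : M ↦ TangentSpace I x) x).continuousLinearMapAt ℝ x)
        |>.le_of_opNorm_le
        hz.1.le ((trivializationAt E (fun x : M ↦ TangentSpace I x) x).symmL ℝ x
        (extChartAt I x y - extChartAt I x x))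
  rw [ContinuousLinearMap.comp_apply, continuousLinearMapAt_comp_symmL_self] at h₄
  exact enorm_le_coe_mul_enorm_of_norm_le h₄

end Local

/-! ### Finiteness, positivity and first-order behaviour of the distance -/

section Distance

variable {E : Type*} [NormedAddCommGroup E] [NormedSpace ℝ E]
  {H : Type*} [TopologicalSpace H] (I : ModelWithCorners ℝ E H)
  {M : Type*} [TopologicalSpace M] [ChartedSpace H M]
  [RiemannianBundle (fun x : M ↦ TangentSpace I x)]

lemma smoothEDist_self (x : M) : smoothEDist I x x = 0 := by
  refine le_antisymm ?_ bot_le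
  exact (smoothEDist_le_pathELength (γ := fun (t : ℝ) ↦ x) (a := 0) (b := 0)
    contMDiffOn_const rfl rfl le_rfl).trans_eq (by simp)

lemma riemDist_self (x : M) : riemDist I x x = 0 := by
  simp [riemDist_eq_toReal_smoothEDist, smoothEDist_self]

variable [IsManifold I ∞ M] [IsContinuousRiemannianBundle E (fun x : M ↦ TangentSpace I x)]

lemma eventually_smoothEDist_lt_top (x : M) : ∀ᶠ y in 𝓝 x, smoothEDist I x y < ⊤ := by
  have : IsManifold I 1 M := .of_le (n := ∞) (by simp)
  filter_upwards [eventually_smoothEDist_le_mul_enorm_symmL I x one_lt_two] with y hy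
  exact hy.trans_lt (ENNReal.mul_lt_top ENNReal.coe_lt_top enorm_lt_top)

lemma smoothEDist_lt_top [PreconnectedSpace M] (x y : M) : smoothEDist I x y < ⊤ := by
  have hclopen : IsClopen {z : M | smoothEDist I x z < ⊤} := by
    refine ⟨⟨isOpen_iff_mem_nhds.2 fun z hz ↦ ?_⟩, isOpen_iff_mem_nhds.2 fun z hz ↦ ?_⟩
    · filter_upwards [eventually_smoothEDist_lt_top I z] with w hw hxw
      rw [smoothEDist_comm] at hw
      exact hz (smoothEDist_triangle.trans_lt (ENNReal.add_lt_top.2 ⟨hxw, hw⟩))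
    · filter_upwards [eventually_smoothEDist_lt_top I z] with w hw
      exact smoothEDist_triangle.trans_lt (ENNReal.add_lt_top.2 ⟨hz, hw⟩)
  have := hclopen.eq_univ ⟨x, by simp [smoothEDist_self]⟩
  exact this.ge (mem_univ y)

lemma riemDist_pos [PreconnectedSpace M] [T1Space M] [RegularSpace M] {x y : M} (h : x ≠ y) :
    0 < riemDist I x y := by
  have : IsManifold I 1 M := .of_le (n := ∞) (by simp)
  obtain ⟨c, c_pos, hc⟩ := setOfPred_riemannianEDist_lt_subset_nhds' I
    (isOpen_compl_singleton.mem_nhds h : ({y}ᶜ : Set M) ∈ 𝓝 x)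
  refine ENNReal.toReal_pos ?_ (smoothEDist_lt_top I x y).ne
  have h' : c ≤ riemannianEDist I x y := by
    by_contra! hlt
    exact hc hlt rfl
  exact (c_pos.trans_le (h'.trans riemannianEDist_le_smoothEDist)).ne'

/-- Near `x`, the Riemannian distance to `x` is equivalent to the norm, for the metric at `x`, of
the coordinates centered at `x`. -/
lemma riemDist_isEquivalent_norm_symmL [RegularSpace M] (x : M) :
    Asymptotics.IsEquivalent (𝓝 x) (fun y ↦ riemDist I x y)
      (fun y ↦ ‖(trivializationAt E (fun x : M ↦ TangentSpace I x) x).symmL ℝ x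
        (extChartAt I x y - extChartAt I x x)‖) := by
  have : IsManifold I 1 M := .of_le (n := ∞) (by simp)
  refine Asymptotics.IsLittleO.of_bound fun ε hε ↦ ?_
  -- From `‖G‖ ≤ (1 + δ) d` and `d ≤ (1 + δ) ‖G‖` one gets `‖G‖ - d ≤ δ (1 + δ) ‖G‖`, which is at
  -- most `ε ‖G‖` once `δ ≤ 1` and `2 δ ≤ ε`.
  set δ : ℝ := min 1 (ε / 2) with hδ
  have hδ0 : 0 < δ := by positivity
  have hδ1 : δ ≤ 1 := min_le_left _ _
  have hδε : 2 * δ ≤ ε := by linarith [min_le_right 1 (ε / 2)]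
  lift δ to ℝ≥0 using hδ0.le with δ'
  have hr : 1 < 1 + δ' := by
    have : 0 < δ' := mod_cast hδ0
    simpa
  filter_upwards [eventually_smoothEDist_le_mul_enorm_symmL I x hr,
    eventually_enorm_symmL_le_mul_riemannianEDist I x hr,
    eventually_smoothEDist_lt_top I x] with y h₁ h₂ h₃
  simp only [Pi.sub_apply]
  generalize (trivializationAt E (fun x : M ↦ TangentSpace I x) x).symmL ℝ x
        (extChartAt I x y - extChartAt I x x) = G at h₁ h₂ ⊢
  have h₁' : riemDist I x y ≤ (1 + δ') * ‖G‖ := by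
    have := ENNReal.toReal_mono (ENNReal.mul_ne_top ENNReal.coe_ne_top enorm_ne_top) h₁
    simpa [ENNReal.toReal_mul, ENNReal.toReal_add, riemDist_eq_toReal_smoothEDist] using this
  have h₂' : ‖G‖ ≤ (1 + δ') * riemDist I x y := by
    have := ENNReal.toReal_mono (ENNReal.mul_ne_top ENNReal.coe_ne_top h₃.ne)
      (h₂.trans (mul_le_mul_right riemannianEDist_le_smoothEDist _))
    simpa [ENNReal.toReal_mul, ENNReal.toReal_add, riemDist_eq_toReal_smoothEDist] using this
  rw [norm_norm, Real.norm_eq_abs, abs_le]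
  have hG := norm_nonneg G
  have hd := mul_le_mul_of_nonneg_left h₁' hδ0.le
  have hδG := mul_le_mul_of_nonneg_right hδ1 (mul_nonneg hδ0.le hG)
  have hεG := mul_le_mul_of_nonneg_right hδε hG
  constructor <;> linarith [mul_nonneg hδ0.le hG]

/-- The Riemannian distance along a curve is asymptotic to its speed. -/
lemma tendsto_riemDist_div [RegularSpace M] {c : ℝ → M} (hc : MDiffAt c 0) :
    Tendsto (fun t ↦ riemDist I (c 0) (c t) / t) (𝓝[>] 0)
      (𝓝 ‖(mfderiv 𝓘(ℝ, ℝ) I c 0 (1 : ℝ) : TangentSpace I (c 0))‖) := by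
  have : IsManifold I 1 M := .of_le (n := ∞) (by simp)
  set L := (trivializationAt E (fun x : M ↦ TangentSpace I x) (c 0)).symmL ℝ (c 0)
  have hφ : MDifferentiableAt I 𝓘(ℝ, E) (extChartAt I (c 0)) (c 0) :=
    mdifferentiableAt_extChartAt (mem_chart_source H (c 0))
  let D : ℝ →L[ℝ] E :=
    (mfderiv I 𝓘(ℝ, E) (extChartAt I (c 0)) (c 0)).comp (mfderiv 𝓘(ℝ, ℝ) I c 0)
  have hφD : HasFDerivAt (extChartAt I (c 0) ∘ c) D 0 :=
    hasMFDerivAt_iff_hasFDerivAt.1 (hφ.hasMFDerivAt.comp (0 : ℝ) hc.hasMFDerivAt)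
  have hφc : HasDerivAt (F := E) (extChartAt I (c 0) ∘ c)
      (mfderiv I 𝓘(ℝ, E) (extChartAt I (c 0)) (c 0) (mfderiv 𝓘(ℝ, ℝ) I c 0 (1 : ℝ))) 0 :=
    hφD.hasDerivAt
  have hG : HasDerivAt (fun t ↦ L (extChartAt I (c 0) (c t) - extChartAt I (c 0) (c 0)))
      (mfderiv 𝓘(ℝ, ℝ) I c 0 (1 : ℝ) : TangentSpace I (c 0)) 0 := by
    rw [← TangentBundle.continuousLinearMapAt_trivializationAt (mem_chart_source H (c 0))] at hφc
    have h := L.hasFDerivAt.comp_hasDerivAt (0 : ℝ)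
      (HasDerivAt.sub_const (F := E) (extChartAt I (c 0) (c 0)) hφc)
    -- At the centre of the chart `L` inverts the derivative of the chart, so the derivative is the
    -- velocity of `c` itself.
    have h' := symmL_comp_continuousLinearMapAt_self I (c 0) (mfderiv 𝓘(ℝ, ℝ) I c 0 (1 : ℝ))
    rw [← h']
    exact h
  have hlim : Tendsto (fun t ↦ ‖L (extChartAt I (c 0) (c t) - extChartAt I (c 0) (c 0))‖ / t)
      (𝓝[>] 0) (𝓝 ‖(mfderiv 𝓘(ℝ, ℝ) I c 0 (1 : ℝ) : TangentSpace I (c 0))‖) := by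
    have h := (hG.tendsto_slope_zero_right).norm
    refine h.congr' ?_
    filter_upwards [self_mem_nhdsWithin] with t ht
    have ht : 0 < t := ht
    simp [norm_smul, abs_of_pos ht, div_eq_inv_mul]
  have heq := ((riemDist_isEquivalent_norm_symmL I (c 0)).comp_tendsto
    (hc.continuousAt.tendsto.mono_left (nhdsWithin_le_nhds (s := Ioi 0)))).div
    (Asymptotics.IsEquivalent.refl (u := fun t : ℝ ↦ t))
  exact heq.symm.tendsto_nhds hlim

omit [RiemannianBundle (fun x : M ↦ TangentSpace I x)]
  [IsContinuousRiemannianBundle E (fun x : M ↦ TangentSpace I x)] in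
-- The curve is a line in the chart at `p`. Only its germ at `0` matters, so it may leave the chart
-- target later.
lemma exists_curve_mfderiv_eq [I.Boundaryless] (p : M) (v : TangentSpace I p) :
    ∃ c : ℝ → M, c 0 = p ∧ MDifferentiableAt 𝓘(ℝ, ℝ) I c 0 ∧
      (mfderiv 𝓘(ℝ, ℝ) I c 0 (1 : ℝ) : E) = v := by
  have : IsManifold I 1 M := .of_le (n := ∞) (by simp)
  set u : E := (trivializationAt E (TangentSpace I) p).continuousLinearMapAt ℝ p v with hu
  let ℓ : ℝ → E := fun t ↦ extChartAt I p p + t • u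
  have hℓ0 : ℓ 0 = extChartAt I p p := by simp [ℓ]
  have hℓ : HasFDerivAt ℓ (ContinuousLinearMap.toSpanSingleton ℝ u) 0 := by
    have h : HasDerivAt ℓ ((1 : ℝ) • u) 0 := ((hasDerivAt_id (0 : ℝ)).smul_const u).const_add _
    rw [one_smul] at h
    exact h.hasFDerivAt
  have hφ : HasMFDerivAt 𝓘(ℝ, E) I (extChartAt I p).symm (ℓ 0)
      (mfderivWithin 𝓘(ℝ, E) I (extChartAt I p).symm (range I) (ℓ 0)) := by
    have h := (mdifferentiableWithinAt_extChartAt_symm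
      (hℓ0 ▸ mem_extChartAt_target p : ℓ 0 ∈ (extChartAt I p).target)).hasMFDerivWithinAt
    rw [I.range_eq_univ] at h ⊢
    exact hasMFDerivWithinAt_univ.1 h
  have hc := hφ.comp (0 : ℝ) (hasMFDerivAt_iff_hasFDerivAt.2 hℓ)
  refine ⟨(extChartAt I p).symm ∘ ℓ, by simp [ℓ], hc.mdifferentiableAt, ?_⟩
  rw [hc.mfderiv, hℓ0, ← TangentBundle.symmL_trivializationAt (mem_chart_source H p)]
  have h := symmL_comp_continuousLinearMapAt_self I p v
  have h1 : ContinuousLinearMap.toSpanSingleton ℝ u 1 = u := one_smul ℝ u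
  refine Eq.trans ?_ h
  exact congrArg (fun w : E ↦ (trivializationAt E (TangentSpace I) p).symmL ℝ p w) h1

end Distance

/-- A continuous absolutely homogeneous function which vanishes only at the origin has constant
sign. -/
lemma not_lt_zero_of_abs_homogeneous {V : Type*} [AddCommGroup V] [Module ℝ V]
    [TopologicalSpace V] [ContinuousAdd V] [ContinuousSMul ℝ V] {h : V → ℝ} (hcont : Continuous h)
    (hsmul : ∀ (a : ℝ) (v : V), h (a • v) = |a| * h v) (hne : ∀ v ≠ 0, h v ≠ 0) {v w : V}
    (hv : 0 < h v) : ¬ h w < 0 := by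
  intro hw
  obtain ⟨s, -, hs⟩ : (0 : ℝ) ∈ (fun s : ℝ ↦ h ((1 - s) • v + s • w)) '' Icc 0 1 := by
    refine intermediate_value_Icc' zero_le_one (by fun_prop) ?_
    simp [hv.le, hw.le]
  have h0 : (1 - s) • v + s • w = 0 := by
    by_contra hn
    exact hne _ hn hs
  -- The segment can meet the zero set only at the origin, where `(1 - s) v = -s w`; homogeneity
  -- then equates a nonnegative and a nonpositive number. This also covers dimension one, where the
  -- nonzero vectors are disconnected.
  have h1 : |1 - s| * h v = |s| * h w := by
    rw [← hsmul, eq_neg_of_add_eq_zero_left h0, ← neg_smul, hsmul, abs_neg]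
  have h2 : |s| * h w ≤ 0 := mul_nonpos_of_nonneg_of_nonpos (abs_nonneg s) hw.le
  have h3 : |1 - s| = 0 := by
    have := abs_nonneg (1 - s)
    nlinarith
  have h4 : s = 1 := by linarith [abs_eq_zero.1 h3]
  subst h4
  simp at h1
  exact hw.ne h1.symm

/-! ### The sign of the stretch excess -/

section Ratio

variable {E : Type*} [NormedAddCommGroup E] [NormedSpace ℝ E]
  {H : Type*} [TopologicalSpace H] {I : ModelWithCorners ℝ E H}
  {M : Type*} [TopologicalSpace M] [ChartedSpace H M]
  [RiemannianBundle (fun x : M ↦ TangentSpace I x)]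
  {E' : Type*} [NormedAddCommGroup E'] [NormedSpace ℝ E']
  {H' : Type*} [TopologicalSpace H'] {J : ModelWithCorners ℝ E' H'}
  {N : Type*} [TopologicalSpace N] [ChartedSpace H' N]
  [RiemannianBundle (fun x : N ↦ TangentSpace J x)]

variable (I J) in
/-- The excess of the length of the image of a tangent vector over `r` times its length. -/
noncomputable def stretchExcess (F : M → N) (r : ℝ) (p : M) (v : TangentSpace I p) : ℝ :=
  ‖(mfderiv I J F p v : TangentSpace J (F p))‖ - r * ‖v‖

lemma stretchExcess_smul (F : M → N) (r : ℝ) (p : M) (a : ℝ) (v : TangentSpace I p) :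
    stretchExcess I J F r p (a • v) = |a| * stretchExcess I J F r p v := by
  simp only [stretchExcess, map_smul, norm_smul, Real.norm_eq_abs]
  ring

lemma continuous_stretchExcess (F : M → N) (r : ℝ) (p : M) :
    Continuous (stretchExcess I J F r p) :=
  ((mfderiv I J F p).continuous.norm).sub (continuous_norm.const_mul r)

lemma stretchExcess_zero (F : M → N) (r : ℝ) (p : M) : stretchExcess I J F r p 0 = 0 := by
  simp [stretchExcess]

variable [IsManifold I 1 M] [IsContinuousRiemannianBundle E (fun x : M ↦ TangentSpace I x)]
  [IsManifold J 1 N] [IsContinuousRiemannianBundle E' (fun x : N ↦ TangentSpace J x)]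

/-- Extend `v` with constant coordinates in the trivialization at `p`; the tangent map and both
metrics are continuous. This makes strict inequalities on the excess open conditions on the base
point. -/
lemma exists_continuousAt_stretchExcess {F : M → N} (hF : ContMDiff I J 1 F) (r : ℝ)
    (p : M) (v : TangentSpace I p) :
    ∃ V : ∀ q : M, TangentSpace I q, V p = v ∧
      ContinuousAt (fun q ↦ stretchExcess I J F r q (V q)) p := by
  set e := trivializationAt E (fun x : M ↦ TangentSpace I x) p
  have hp : p ∈ e.baseSet := FiberBundle.mem_baseSet_trivializationAt' p
  let V : ∀ q : M, TangentSpace I q := fun q ↦ e.symmL ℝ q (e.continuousLinearMapAt ℝ p v)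
  have hV : ContinuousAt (fun q ↦ (⟨q, V q⟩ : TotalSpace E (fun x : M ↦ TangentSpace I x))) p := by
    rw [FiberBundle.continuousAt_totalSpace]
    refine ⟨continuousAt_id, ?_⟩
    refine (continuousAt_const (y := e.continuousLinearMapAt ℝ p v)).congr ?_
    filter_upwards [e.open_baseSet.mem_nhds hp] with q hq
    have h := e.continuousLinearMapAt_symmL (R := ℝ) hq (e.continuousLinearMapAt ℝ p v)
    rw [e.continuousLinearMapAt_apply ℝ, e.coe_linearMapAt_of_mem hq] at h
    exact h.symm
  have hW : ContinuousAt (fun q ↦ (⟨F q, mfderiv I J F q (V q)⟩ :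
      TotalSpace E' (fun x : N ↦ TangentSpace J x))) p :=
    (hF.continuous_tangentMap le_rfl).continuousAt.comp hV
  refine ⟨V, e.symmL_continuousLinearMapAt hp v, ?_⟩
  have h₁ := (hV.inner_bundle hV).sqrt
  have h₂ := (hW.inner_bundle hW).sqrt
  simp only [← norm_eq_sqrt_real_inner] at h₁ h₂
  exact h₂.sub (h₁.const_mul r)

/-- On a connected manifold, the length ratios of a `C^1` map which avoid the value `r` all lie on
the same side of `r`. -/
lemma stretchExcess_nonpos_or_nonneg [PreconnectedSpace M] {F : M → N} (hF : ContMDiff I J 1 F)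
    {r : ℝ} (hr : ∀ (p : M) (v : TangentSpace I p), v ≠ 0 → stretchExcess I J F r p v ≠ 0) :
    (∀ p v, stretchExcess I J F r p v ≤ 0) ∨ (∀ p v, 0 ≤ stretchExcess I J F r p v) := by
  let A : Set M := {p | ∃ v, 0 < stretchExcess I J F r p v}
  let B : Set M := {p | ∃ v, stretchExcess I J F r p v < 0}
  have hAB {p : M} (hA : p ∈ A) (hB : p ∈ B) : False := by
    obtain ⟨v, hv⟩ := hA
    obtain ⟨w, hw⟩ := hB
    exact not_lt_zero_of_abs_homogeneous (continuous_stretchExcess F r p)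
      (stretchExcess_smul F r p) (hr p) hv hw
  have hAo : IsOpen A := isOpen_iff_mem_nhds.2 fun p ⟨v, hv⟩ ↦ by
    obtain ⟨V, rfl, hV⟩ := exists_continuousAt_stretchExcess hF r p v
    filter_upwards [hV.eventually_const_lt hv] with q hq using ⟨_, hq⟩
  have hBo : IsOpen B := isOpen_iff_mem_nhds.2 fun p ⟨v, hv⟩ ↦ by
    obtain ⟨V, rfl, hV⟩ := exists_continuousAt_stretchExcess hF r p v
    filter_upwards [hV.eventually_lt_const hv] with q hq using ⟨_, hq⟩
  by_contra! hcon
  obtain ⟨⟨p, v, hv⟩, q, w, hw⟩ := hcon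
  have hv0 : v ≠ 0 := by
    rintro rfl
    simp [stretchExcess_zero] at hv
  have huniv : A ∪ B = univ := by
    refine eq_univ_of_forall fun z ↦ ?_
    -- Every tangent space is a copy of `E`, so a nonzero vector at one point supplies one at every
    -- point; no continuity in `z` is needed.
    let v' : TangentSpace I z := (v : E)
    rcases (hr z v' hv0).lt_or_gt with h | h
    · exact Or.inr ⟨_, h⟩
    · exact Or.inl ⟨_, h⟩
  obtain ⟨z, hzA, hzB⟩ := nonempty_inter hAo hBo huniv ⟨p, v, hv⟩ ⟨q, w, hw⟩
  exact hAB hzA hzB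

end Ratio

/-! ### The two inclusions -/

section Main

variable {E : Type*} [NormedAddCommGroup E] [NormedSpace ℝ E]
  {H : Type*} [TopologicalSpace H] {I : ModelWithCorners ℝ E H}
  {M : Type*} [TopologicalSpace M] [ChartedSpace H M]
  [RiemannianBundle (fun x : M ↦ TangentSpace I x)]
  {E' : Type*} [NormedAddCommGroup E'] [NormedSpace ℝ E']
  {H' : Type*} [TopologicalSpace H'] {J : ModelWithCorners ℝ E' H'}
  {N : Type*} [TopologicalSpace N] [ChartedSpace H' N]
  [RiemannianBundle (fun x : N ↦ TangentSpace J x)]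

lemma sqrt_pullbackInner_div (F : M → N) (p : M) (v : TangentSpace I p) :
    √(pullbackInner I J F p v v) / √(inner ℝ v v) =
      ‖(mfderiv I J F p v : TangentSpace J (F p))‖ / ‖v‖ := by
  rw [norm_eq_sqrt_real_inner, norm_eq_sqrt_real_inner, pullbackInner]

omit [RiemannianBundle (fun x : M ↦ TangentSpace I x)] in
lemma norm_mfderiv_mfderiv_of_rightInverse {F : M → N} {G : N → M} (hFG : F ∘ G = id) {y : N}
    (hF : MDifferentiableAt I J F (G y)) (hG : MDifferentiableAt J I G y) (w : TangentSpace J y) :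
    ‖(mfderiv I J F (G y) (mfderiv J I G y w) : TangentSpace J (F (G y)))‖ = ‖w‖ := by
  -- Abstracting `F ∘ G` to a variable lets the tangent space at `K y` be replaced along with `K`.
  have key (K : N → N) (hK : K = id) : ‖(mfderiv J J K y w : TangentSpace J (K y))‖ = ‖w‖ := by
    subst hK
    rw [mfderiv_id]
    rfl
  have h := key _ hFG
  rwa [mfderiv_comp y hF hG] at h

variable [IsManifold I ∞ M] [IsContinuousRiemannianBundle E (fun x : M ↦ TangentSpace I x)]

lemma riemDist_map_le [PreconnectedSpace M] {F : M → N} (hF : ContMDiff I J ∞ F) {C : ℝ}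
    (hC₀ : 0 < C) (hC : ∀ (p : M) (v : TangentSpace I p),
      ‖(mfderiv I J F p v : TangentSpace J (F p))‖ ≤ C * ‖v‖) (p q : M) :
    riemDist J (F p) (F q) ≤ C * riemDist I p q := by
  lift C to ℝ≥0 using hC₀.le
  have h := smoothEDist_map_le hF (mod_cast hC₀)
    (fun p v ↦ enorm_le_coe_mul_enorm_of_norm_le (hC p v)) p q
  have h' := ENNReal.toReal_mono
    (ENNReal.mul_ne_top ENNReal.coe_ne_top (smoothEDist_lt_top I p q).ne) h
  simpa [ENNReal.toReal_mul, riemDist_eq_toReal_smoothEDist] using h'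

variable [IsManifold J ∞ N] [IsContinuousRiemannianBundle E' (fun x : N ↦ TangentSpace J x)]

theorem metricDistortionRange_subset [I.Boundaryless] [RegularSpace M] [RegularSpace N]
    {F : M → N} (hF : ContMDiff I J ∞ F) :
    metricDistortionRange I J F ⊆ distanceDistortionRange I J F := by
  refine closure_minimal ?_ isClosed_closure
  rintro _ ⟨p, v, hv, rfl⟩
  rw [sqrt_pullbackInner_div]
  obtain ⟨c, rfl, hc, hcv⟩ := exists_curve_mfderiv_eq I p v
  have hFc : MDifferentiableAt I J F (c 0) := hF.mdifferentiableAt (by simp)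
  have h₁ := tendsto_riemDist_div I hc
  have h₂ := tendsto_riemDist_div J (hFc.comp (0 : ℝ) hc)
  rw [mfderiv_comp (0 : ℝ) hFc hc] at h₂
  replace h₁ : Tendsto (fun t ↦ riemDist I (c 0) (c t) / t) (𝓝[>] 0) (𝓝 ‖v‖) := by
    rw [← hcv]; exact h₁
  replace h₂ : Tendsto (fun t ↦ riemDist J (F (c 0)) (F (c t)) / t) (𝓝[>] 0)
      (𝓝 ‖(mfderiv I J F (c 0) v : TangentSpace J (F (c 0)))‖) := by
    rw [← hcv]; exact h₂
  have hv' : 0 < ‖v‖ := norm_pos_iff.2 hv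
  refine mem_closure_of_tendsto (h₂.div h₁ hv'.ne') ?_
  filter_upwards [h₁.eventually_const_lt hv', self_mem_nhdsWithin] with t ht ht0
  refine ⟨c 0, c t, fun h ↦ ?_, div_div_div_cancel_right₀ (ne_of_gt ht0) _ _⟩
  rw [← h, riemDist_self] at ht
  simp at ht

theorem distanceDistortionRange_subset [ConnectedSpace M] [T2Space M] [RegularSpace M]
    [T2Space N] [RegularSpace N] (F : M ≃ₘ^∞⟮I, J⟯ N) :
    distanceDistortionRange I J F ⊆ metricDistortionRange I J F := by
  have : IsManifold I 1 M := .of_le (n := ∞) (by simp)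
  have : IsManifold J 1 N := .of_le (n := ∞) (by simp)
  have : ConnectedSpace N := F.toHomeomorph.surjective.connectedSpace F.continuous
  refine closure_minimal ?_ isClosed_closure
  rintro _ ⟨p, q, hpq, rfl⟩
  have hdM : 0 < riemDist I p q := riemDist_pos I hpq
  have hdN : 0 < riemDist J (F p) (F q) := riemDist_pos J (F.injective.ne hpq)
  set R := riemDist J (F p) (F q) / riemDist I p q with hR
  have hR0 : 0 < R := div_pos hdN hdM
  have hdR : riemDist J (F p) (F q) = R * riemDist I p q := by
    rw [hR, div_mul_cancel₀ _ hdM.ne']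
  by_contra hmem
  obtain ⟨ε, hε, hball⟩ := Metric.isOpen_iff.1 isClosed_closure.isOpen_compl R hmem
  have hgap (p : M) (v : TangentSpace I p) (hv : v ≠ 0) :
      ε ≤ |‖(mfderiv I J F p v : TangentSpace J (F p))‖ / ‖v‖ - R| := by
    by_contra! hlt
    refine hball (show _ ∈ Metric.ball R ε from hlt) (subset_closure ⟨p, v, hv, ?_⟩)
    rw [sqrt_pullbackInner_div]
  have hne (p : M) (v : TangentSpace I p) (hv : v ≠ 0) : stretchExcess I J F R p v ≠ 0 := by
    intro h
    have h' := hgap p v hv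
    rw [(div_eq_iff (norm_pos_iff.2 hv).ne').2 (sub_eq_zero.1 h)] at h'
    simp at h'
    exact h'.not_gt hε
  rcases stretchExcess_nonpos_or_nonneg (F.contMDiff.of_le (by simp)) hne with h | h
  -- The term `R / 2` keeps the Lipschitz constant positive when `ε ≥ R`.
  · set δ := max (R - ε) (R / 2)
    have hδ0 : 0 < δ := lt_max_of_lt_right (by positivity)
    have hδR : δ < R := max_lt (by linarith) (by linarith)
    have hle (p : M) (v : TangentSpace I p) :
        ‖(mfderiv I J F p v : TangentSpace J (F p))‖ ≤ δ * ‖v‖ := by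
      rcases eq_or_ne v 0 with rfl | hv
      · simp
      have hv' := norm_pos_iff.2 hv
      have h1 : ‖(mfderiv I J F p v : TangentSpace J (F p))‖ / ‖v‖ - R ≤ 0 := by
        rw [sub_nonpos, div_le_iff₀ hv']
        exact sub_nonpos.1 (h p v)
      have h2 := hgap p v hv
      rw [abs_of_nonpos h1] at h2
      rw [← div_le_iff₀ hv']
      exact le_max_of_le_left (by linarith)
    have h3 := riemDist_map_le F.contMDiff hδ0 hle p q
    nlinarith
  · have hle (p : M) (v : TangentSpace I p) :
        (R + ε) * ‖v‖ ≤ ‖(mfderiv I J F p v : TangentSpace J (F p))‖ := by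
      rcases eq_or_ne v 0 with rfl | hv
      · simp
      have hv' := norm_pos_iff.2 hv
      have h1 : 0 ≤ ‖(mfderiv I J F p v : TangentSpace J (F p))‖ / ‖v‖ - R := by
        rw [sub_nonneg, le_div_iff₀ hv']
        exact sub_nonneg.1 (h p v)
      have h2 := hgap p v hv
      rw [abs_of_nonneg h1] at h2
      rw [← le_div_iff₀ hv']
      linarith
    have hpos : 0 < R + ε := by positivity
    have hle' (y : N) (w : TangentSpace J y) :
        ‖(mfderiv J I F.symm y w : TangentSpace I (F.symm y))‖ ≤ (R + ε)⁻¹ * ‖w‖ := by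
      rw [le_inv_mul_iff₀ hpos, ← norm_mfderiv_mfderiv_of_rightInverse (F := F) (G := F.symm)
        (funext F.apply_symm_apply) (F.contMDiff.mdifferentiableAt (by simp))
        (F.symm.contMDiff.mdifferentiableAt (by simp)) w]
      exact hle _ _
    have h3 := riemDist_map_le F.symm.contMDiff (inv_pos.2 hpos) hle' (F p) (F q)
    rw [F.symm_apply_apply, F.symm_apply_apply, le_inv_mul_iff₀ hpos] at h3
    nlinarith

end Main

end MetricDistortion

theorem mainTheorem3 (n : ℕ)
    {M : Type*} [TopologicalSpace M] [T2Space M] [ConnectedSpace M]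
    [ChartedSpace (EuclideanSpace ℝ (Fin n)) M] [IsManifold (𝓡 n) ∞ M]
    [RiemannianBundle (fun x : M ↦ TangentSpace (𝓡 n) x)]
    [IsContMDiffRiemannianBundle (𝓡 n) ∞ (EuclideanSpace ℝ (Fin n))
      (fun x : M ↦ TangentSpace (𝓡 n) x)]
    {N : Type*} [TopologicalSpace N] [T2Space N] [ConnectedSpace N]
    [ChartedSpace (EuclideanSpace ℝ (Fin n)) N] [IsManifold (𝓡 n) ∞ N]
    [RiemannianBundle (fun x : N ↦ TangentSpace (𝓡 n) x)]
    [IsContMDiffRiemannianBundle (𝓡 n) ∞ (EuclideanSpace ℝ (Fin n))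
      (fun x : N ↦ TangentSpace (𝓡 n) x)]
    (F : M ≃ₘ^∞⟮𝓡 n, 𝓡 n⟯ N) :
    MetricDistortion.metricDistortionRange (𝓡 n) (𝓡 n) F =
      MetricDistortion.distanceDistortionRange (𝓡 n) (𝓡 n) F := by
  -- Local compactness with the Hausdorff property yields the regularity used by both inclusions.
  have : LocallyCompactSpace M := Manifold.locallyCompact_of_finiteDimensional (𝓡 n)
  have : LocallyCompactSpace N := Manifold.locallyCompact_of_finiteDimensional (𝓡 n)
  have : IsContinuousRiemannianBundle (EuclideanSpace ℝ (Fin n))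
      (fun x : M ↦ TangentSpace (𝓡 n) x) :=
    let ⟨g, hg, hg'⟩ := IsContMDiffRiemannianBundle.exists_contMDiff (IB := 𝓡 n) (n := ∞)
      (F := EuclideanSpace ℝ (Fin n)) (E := fun x : M ↦ TangentSpace (𝓡 n) x)
    ⟨g, hg.continuous, hg'⟩
  have : IsContinuousRiemannianBundle (EuclideanSpace ℝ (Fin n))
      (fun x : N ↦ TangentSpace (𝓡 n) x) :=
    let ⟨g, hg, hg'⟩ := IsContMDiffRiemannianBundle.exists_contMDiff (IB := 𝓡 n) (n := ∞)
      (F := EuclideanSpace ℝ (Fin n)) (E := fun x : N ↦ TangentSpace (𝓡 n) x)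
    ⟨g, hg.continuous, hg'⟩
  exact (MetricDistortion.metricDistortionRange_subset F.contMDiff).antisymm
    (MetricDistortion.distanceDistortionRange_subset F)
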